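/- Let $G$ be a locally compact group and $1<p<\infty$. A $QSL_p$-space is a complex Banach space isometrically isomorphic to a quotient (by a closed subspace) of a closed subspace of some space $L_p(X,\mu)$. A representation $(\pi,E)$ of $G$ is a homomorphism $\pi$ from $G$ into the invertible isometries of a Banach space $E$ that is continuous for the strong operator topology; it is cyclic if there is $\xi_0\in E$ such that $\{\int_G f(x)\pi(x)\xi_0\,dx : f\in L_1(G)\}$ is dense in $E$. Let $B_p(G)$ be the set of all functions $u:G\to\mathbb{C}$ of the form $$u(x)=\sum_{n=1}^\infty\langle\pi_n(x)\xi_n,\eta_n\rangle\quad(x\in G),\qquad \sum_{n=1}^\infty\|\xi_n\|\,\|\eta_n\|<\infty,$$ where the $(\pi_n,E_n)$ are cyclic representations of $G$ on $QSL_p$-spaces, $\xi_n\in E_n$ and $\eta_n\in E_n^*$, and let $\|u\|_{B_p(G)}$ be the infimum of $\sum_n\|\xi_n\|\|\eta_n\|$ over all such expressions of $u$. Let $\Omega_0(G)$ be the ring of subsets of $G$ generated by the open cosets (cosets of open subgroups). (1) If $Y\in\Omega_0(G)$, then $\chi_Y\in B_p(G)$, and $\|\chi_Y\|_{B_p(G)}\ge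 1$ if $Y\neq\emptyset$. (2) Let $Y\subseteq G$ have the form $$Y=Y_0\setminus\bigcup_{i=1}^m Y_i,\qquad (*)$$ where $m\ge 0$, $Y_0$ is an open coset of $G$, and $Y_1,\dots,Y_m\subseteq Y_0$ are open cosets of infinite index in $Y_0$. Then $Y\in\Omega_0(G)$, $\chi_Y\in B_p(G)$, and $$1\le\|\chi_Y\|_{B_p(G)}\le 2^{m_Y},$$ where $m_Y$ is the least $m\ge 0$ for which $Y$ has an expression $(*)$. -/

import Mathlib

open MeasureTheory
open scoped ENNReal Pointwise

universe u

/-- A complex Banach space `E` is a `QSL_p`-space if it is isometrically isomorphic to a quotient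
(by a closed subspace) of a closed subspace of some `L_p(X, μ)`. -/
def IsQSLp (p : ℝ≥0∞) [Fact (1 ≤ p)] (E : Type u) [NormedAddCommGroup E] [NormedSpace ℂ E] : Prop :=
  ∃ (X : Type u) (_ : MeasurableSpace X) (μ : Measure X)
    (S : Submodule ℂ (Lp ℂ p μ)) (N : Submodule ℂ S),
    IsClosed (S : Set (Lp ℂ p μ)) ∧ IsClosed (N : Set S) ∧ Nonempty (E ≃ₗᵢ[ℂ] (S ⧸ N))

/-- A representation of the topological group `G`: a homomorphism from `G` into the invertible
isometries of a complex Banach space, continuous for the strong operator topology. -/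
structure IsometricRep (G : Type u) [Group G] [TopologicalSpace G] where
  space : Type u
  [normedAddCommGroup : NormedAddCommGroup space]
  [normedSpace : NormedSpace ℂ space]
  [completeSpace : CompleteSpace space]
  toHom : G →* (space ≃ₗᵢ[ℂ] space)
  strongly_continuous : ∀ ξ : space, Continuous fun x : G => toHom x ξ

attribute [instance] IsometricRep.normedAddCommGroup IsometricRep.normedSpace
  IsometricRep.completeSpace

namespace IsometricRep

variable {G : Type u} [Group G] [TopologicalSpace G]

/-- The integrated form `π(f)ξ = ∫ f(x) π(x)ξ dx`, with respect to a left Haar measure. -/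
noncomputable def integrated [IsTopologicalGroup G] [LocallyCompactSpace G] [MeasurableSpace G]
    [BorelSpace G] (π : IsometricRep G) (f : G → ℂ) (ξ : π.space) : π.space :=
  ∫ x, f x • π.toHom x ξ ∂(Measure.haar : Measure G)

/-- `π` is cyclic: `π(L_1(G))ξ₀` is dense for some vector `ξ₀`. -/
def IsCyclic [IsTopologicalGroup G] [LocallyCompactSpace G] [MeasurableSpace G]
    [BorelSpace G] (π : IsometricRep G) : Prop :=
  ∃ ξ₀ : π.space,
    Dense {η : π.space | ∃ f : G → ℂ, Integrable f (Measure.haar : Measure G) ∧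
      η = π.integrated f ξ₀}

end IsometricRep

section FourierStieltjes

variable {G : Type u} [Group G] [TopologicalSpace G] [IsTopologicalGroup G]
  [LocallyCompactSpace G] [MeasurableSpace G] [BorelSpace G]

/-- `u(x) = ∑ ⟨π_n(x) ξ_n, η_n⟩` for a sequence of cyclic representations `π_n` on `QSL_p`-spaces,
vectors `ξ_n` and functionals `η_n`, where `∑ ‖ξ_n‖ ‖η_n‖` converges, with sum `c`. -/
def HasBpExpansion (p : ℝ≥0∞) [Fact (1 ≤ p)] (u : G → ℂ) (c : ℝ) : Prop :=
  ∃ (π : ℕ → IsometricRep G) (ξ : ∀ n, (π n).space) (η : ∀ n, StrongDual ℂ (π n).space),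
    (∀ n, IsQSLp p (π n).space ∧ (π n).IsCyclic) ∧
    HasSum (fun n => ‖ξ n‖ * ‖η n‖) c ∧
    ∀ x : G, HasSum (fun n => η n ((π n).toHom x (ξ n))) (u x)

variable (G) in
/-- The `p`-analog `B_p(G)` of the Fourier-Stieltjes algebra, as a set of functions. -/
def FourierStieltjesBp (p : ℝ≥0∞) [Fact (1 ≤ p)] : Set (G → ℂ) :=
  {u | ∃ c : ℝ, HasBpExpansion p u c}

/-- The norm of `B_p(G)`; meaningful for members of `FourierStieltjesBp G p`. -/
noncomputable def normBp (p : ℝ≥0∞) [Fact (1 ≤ p)] (u : G → ℂ) : ℝ :=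
  sInf {c : ℝ | HasBpExpansion p u c}

end FourierStieltjes

section CosetRing

variable {G : Type u} [Group G] [TopologicalSpace G]

/-- Open cosets of `G`. (A right coset of a subgroup is a left coset of a conjugate subgroup.) -/
def IsOpenCoset (C : Set G) : Prop :=
  ∃ (H : OpenSubgroup G) (a : G), C = a • (H : Set G)

/-- `C` is an open coset contained in the open coset `D`, of infinite index in it. -/
def IsOpenSubcosetOfInfiniteIndex (C D : Set G) : Prop :=
  C ⊆ D ∧ ∃ (H K : OpenSubgroup G) (a b : G), C = a • (H : Set G) ∧ D = b • (K : Set G) ∧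
    ¬ (H : Subgroup G).IsFiniteRelIndex (K : Subgroup G)

variable (G) in
/-- The ring of subsets of `G` generated by the open cosets. -/
def openCosetRing : Set (Set G) :=
  ⋂₀ {R : Set (Set G) | IsSetRing R ∧ ∀ C : Set G, IsOpenCoset C → C ∈ R}

/-- `Y = Y₀ \ (Y₁ ∪ ⋯ ∪ Y_m)` with `Y₀` an open coset and `Y₁, …, Y_m` open subcosets of infinite
index in `Y₀`. -/
def IsCosetDifference (Y : Set G) (m : ℕ) : Prop :=
  ∃ (Y₀ : Set G) (Z : Fin m → Set G), IsOpenCoset Y₀ ∧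
    (∀ i, IsOpenSubcosetOfInfiniteIndex (Z i) Y₀) ∧ Y = Y₀ \ ⋃ i, Z i

/-- The number `m_Y`; meaningful for those `Y` which admit such a decomposition. -/
noncomputable def cosetNumber (Y : Set G) : ℕ :=
  sInf {m : ℕ | IsCosetDifference Y m}

end CosetRing

/-! The indicator of an open coset `aH` is a single coefficient function: `G` permutes the discrete
space `G/H`, hence acts isometrically on `ℓ_p(G/H)`, and evaluating the translate by `x` of the
point mass at `H` at the point `aH` gives 1 if `x ∈ aH` and 0 otherwise. Point mass and evaluation
have norm at most 1, so the cost is at most 1 (`IsOpenCoset.exists_expansion`).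

Open cosets are closed under nonempty intersection, so the span of their indicators is an algebra;
it contains the indicator of every set in the coset ring, and expansions survive linear
combinations. For the upper bound, each removed coset splits the indicator into a difference of two
functions of the same kind, which doubles the cost (`exists_expansion_diff_biUnion`).

The lower bound holds because an expansion of cost `c` bounds the function by `c` everywhere, while
a nonzero indicator takes the value 1. Sets of the form (*) are nonempty by B. H. Neumann's covering
lemma. -/

/-! ### Permutation representations on `ℓ_p(X)` -/

section PermutationRepresentation

variable {X : Type u} [MeasurableSpace X] [DiscreteMeasurableSpace X]

/-- `ℓ_p(X)`, as the `L_p`-space of the counting measure. -/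
abbrev LpCount (p : ℝ≥0∞) (X : Type u) [MeasurableSpace X] : Type u :=
  Lp ℂ p (Measure.count : Measure X)

theorem isQSLp_lp (p : ℝ≥0∞) [Fact (1 ≤ p)] {X : Type u} [MeasurableSpace X] (μ : Measure X) :
    IsQSLp p (Lp ℂ p μ) := by
  refine ⟨X, inferInstance, μ, ⊤, ⊥, by simp, by simp, ⟨?_⟩⟩
  refine (LinearIsometryEquiv.ofTop (Lp ℂ p μ) (⊤ : Submodule ℂ (Lp ℂ p μ)) rfl).symm.trans
    ⟨(Submodule.quotEquivOfEqBot ⊥ rfl).symm, fun x => ?_⟩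
  change ‖(Submodule.Quotient.mk x :
    (⊤ : Submodule ℂ (Lp ℂ p μ)) ⧸ (⊥ : Submodule ℂ (⊤ : Submodule ℂ (Lp ℂ p μ))))‖ = ‖x‖
  refine le_antisymm (Submodule.Quotient.norm_mk_le _ x) ?_
  refine le_of_forall_pos_le_add fun ε hε => ?_
  obtain ⟨m, hm, hlt⟩ := Submodule.Quotient.norm_mk_lt (S := ⊥)
    (Submodule.Quotient.mk x :
      (⊤ : Submodule ℂ (Lp ℂ p μ)) ⧸ (⊥ : Submodule ℂ (⊤ : Submodule ℂ (Lp ℂ p μ)))) hε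
  have : m = x := by
    have := (Submodule.Quotient.eq _).1 hm
    rwa [Submodule.mem_bot, sub_eq_zero] at this
  exact this ▸ hlt.le

theorem LpCount.ext {p : ℝ≥0∞} {X : Type u} [MeasurableSpace X] {f g : LpCount p X} (h : ∀ x, f x = g x) : f = g :=
  Lp.ext (Filter.Eventually.of_forall h)

theorem LpCount.norm_apply_le {p : ℝ≥0∞} [hp : Fact (1 ≤ p)] (hp_top : p ≠ ⊤)
    (f : LpCount p X) (c : X) : ‖f c‖ ≤ ‖f‖ := by
  have h0 : p ≠ 0 := (lt_of_lt_of_le one_pos hp.out).ne'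
  have h := eLpNorm_indicator_le (f := f) (p := p) (μ := Measure.count) (s := {c})
  have h1 : Set.indicator {c} (f : X → ℂ) = Set.indicator {c} (fun _ => f c) := by
    ext x
    by_cases hx : x = c <;> simp [hx]
  rw [h1, eLpNorm_indicator_const (MeasurableSet.singleton c) h0 hp_top] at h
  simp only [Measure.count_singleton, ENNReal.one_rpow, mul_one] at h
  have := ENNReal.toReal_mono (Lp.eLpNorm_ne_top f) h
  simpa [Lp.norm_def] using this

/-- Evaluation at a point, as a functional on `ℓ_p(X)`. -/
noncomputable def LpCount.eval {p : ℝ≥0∞} [Fact (1 ≤ p)] (hp_top : p ≠ ⊤) (c : X) :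
    StrongDual ℂ (LpCount p X) :=
  LinearMap.mkContinuous
    { toFun := fun f => f c
      -- Almost everywhere identities hold at every point, since only the empty set is null for
      -- counting measure.
      map_add' := fun f g => Measure.ae_count_iff.1 (Lp.coeFn_add f g) c
      map_smul' := fun a f => Measure.ae_count_iff.1 (Lp.coeFn_smul a f) c } 1
    fun f => by simpa using LpCount.norm_apply_le hp_top f c

theorem LpCount.eval_apply {p : ℝ≥0∞} [Fact (1 ≤ p)] (hp_top : p ≠ ⊤) (c : X)
    (f : LpCount p X) : LpCount.eval hp_top c f = f c := rfl

theorem LpCount.norm_eval_le {p : ℝ≥0∞} [Fact (1 ≤ p)] (hp_top : p ≠ ⊤) (c : X) :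
    ‖(LpCount.eval hp_top c : StrongDual ℂ (LpCount p X))‖ ≤ 1 :=
  LinearMap.mkContinuous_norm_le _ zero_le_one _

/-- The point mass at `c`, as an element of `ℓ_p(X)`. -/
noncomputable def LpCount.delta (p : ℝ≥0∞) (c : X) : LpCount p X :=
  indicatorConstLp p (MeasurableSet.singleton c) (by simp) 1

open Classical in
theorem LpCount.delta_apply (p : ℝ≥0∞) (c x : X) :
    LpCount.delta p c x = if x = c then (1 : ℂ) else 0 := by
  rw [LpCount.delta, Measure.ae_count_iff.1 indicatorConstLp_coeFn x, Set.indicator_apply]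
  simp only [Set.mem_singleton_iff]

theorem LpCount.norm_delta (p : ℝ≥0∞) [hp : Fact (1 ≤ p)] (hp_top : p ≠ ⊤) (c : X) :
    ‖LpCount.delta p c‖ = 1 := by
  rw [LpCount.delta, norm_indicatorConstLp (lt_of_lt_of_le one_pos hp.out).ne' hp_top]
  simp [Measure.real]

/-- Simple functions are dense for finite `p`, and a set of finite counting measure is finite, so
its indicator is a finite sum of point masses. -/
theorem LpCount.dense_span_delta (p : ℝ≥0∞) [Fact (1 ≤ p)] (hp_top : p ≠ ⊤) :
    Dense (Submodule.span ℂ (Set.range (LpCount.delta p : X → LpCount p X)) :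
      Set (LpCount p X)) := by
  classical
  intro f
  rw [← Submodule.topologicalClosure_coe]
  induction f using Lp.induction hp_top with
  | indicatorConst c hs hμs =>
    rename_i s
    refine Submodule.le_topologicalClosure _ ?_
    have hfin : s.Finite := Measure.count_apply_lt_top.1 hμs
    have key : ((Lp.simpleFunc.indicatorConst p hs hμs.ne c : Lp.simpleFunc ℂ p _) : LpCount p X) =
        ∑ x ∈ hfin.toFinset, c • LpCount.delta p x := by
      rw [Lp.simpleFunc.coe_indicatorConst]
      apply LpCount.ext
      intro y
      rw [Measure.ae_count_iff.1 indicatorConstLp_coeFn y,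
        ← LpCount.eval_apply hp_top y (∑ x ∈ hfin.toFinset, _), map_sum]
      simp only [map_smul, LpCount.eval_apply, LpCount.delta_apply, smul_eq_mul, mul_ite, mul_one,
        mul_zero, Finset.sum_ite_eq, Set.Finite.mem_toFinset]
      by_cases hy : y ∈ s <;> simp [hy]
    rw [key]
    exact Submodule.sum_mem _ fun x _ => Submodule.smul_mem _ _ (Submodule.subset_span ⟨x, rfl⟩)
  | add hf hg _ h1 h2 => exact Submodule.add_mem _ h1 h2
  | isClosed => exact Submodule.isClosed_topologicalClosure _

variable {G : Type u} [Group G] [MulAction G X]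

theorem measurePreserving_smul_count (x : G) :
    MeasurePreserving (fun c : X => x • c) Measure.count Measure.count := by
  refine ⟨Measurable.of_discrete, ?_⟩
  ext s hs
  rw [Measure.map_apply Measurable.of_discrete hs, Set.preimage_smul,
    Measure.count_apply MeasurableSet.of_discrete, Measure.count_apply MeasurableSet.of_discrete,
    Set.encard_smul_set]

/-- Translation on `ℓ_p(X)`. -/
noncomputable def LpCount.translate (p : ℝ≥0∞) [Fact (1 ≤ p)] (x : G) :
    LpCount p X →ₗᵢ[ℂ] LpCount p X :=
  Lp.compMeasurePreservingₗᵢ ℂ (fun c : X => x⁻¹ • c) (measurePreserving_smul_count x⁻¹)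

theorem LpCount.translate_apply (p : ℝ≥0∞) [Fact (1 ≤ p)] (x : G) (f : LpCount p X) (c : X) :
    LpCount.translate p x f c = f (x⁻¹ • c) :=
  Measure.ae_count_iff.1
    (Lp.coeFn_compMeasurePreserving f (measurePreserving_smul_count x⁻¹)) c

theorem LpCount.translate_delta (p : ℝ≥0∞) [Fact (1 ≤ p)] (x : G) (c : X) :
    LpCount.translate p x (LpCount.delta p c) = LpCount.delta p (x • c) := by
  apply LpCount.ext
  intro y
  rw [LpCount.translate_apply, LpCount.delta_apply, LpCount.delta_apply]
  congr 1
  exact propext inv_smul_eq_iff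

/-- Translation on `ℓ_p(X)`, as a homomorphism into the invertible isometries. -/
noncomputable def LpCount.translateHom (p : ℝ≥0∞) [Fact (1 ≤ p)] (G : Type u) [Group G]
    (X : Type u) [MeasurableSpace X] [DiscreteMeasurableSpace X] [MulAction G X] :
    G →* (LpCount p X ≃ₗᵢ[ℂ] LpCount p X) where
  toFun x :=
    { toLinearEquiv := LinearEquiv.ofLinearMap (LpCount.translate p x).toLinearMap
        (LpCount.translate p x⁻¹).toLinearMap
        (LinearMap.ext fun f => LpCount.ext fun c => by simp [LpCount.translate_apply])
        (LinearMap.ext fun f => LpCount.ext fun c => by simp [LpCount.translate_apply])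
      norm_map' := (LpCount.translate p x).norm_map }
  map_one' := by
    ext1 f
    exact LpCount.ext fun c => (LpCount.translate_apply p 1 f c).trans (by simp)
  map_mul' x y := by
    ext1 f
    refine LpCount.ext fun c => ?_
    change LpCount.translate p (x * y) f c =
      LpCount.translate p x (LpCount.translate p y f) c
    simp [LpCount.translate_apply, mul_smul]

theorem LpCount.translateHom_apply (p : ℝ≥0∞) [Fact (1 ≤ p)] (x : G) (f : LpCount p X) :
    LpCount.translateHom p G X x f = LpCount.translate p x f := rfl

variable [TopologicalSpace G]

/-- The orbit map of a point mass is locally constant because the transporter sets are open.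
Translations are isometries, so approximating `f` by combinations of point masses approximates its
orbit map uniformly on `G`. -/
theorem LpCount.continuous_translateHom (p : ℝ≥0∞) [Fact (1 ≤ p)] (hp_top : p ≠ ⊤)
    (hX : ∀ a b : X, IsOpen {x : G | x • a = b}) (f : LpCount p X) :
    Continuous fun x : G => LpCount.translateHom p G X x f := by
  have hspan : ∀ g ∈ Submodule.span ℂ (Set.range (LpCount.delta p : X → LpCount p X)),
      Continuous fun x : G => LpCount.translateHom p G X x g := by
    intro g hg
    induction hg using Submodule.span_induction with
    | mem g hg =>
      obtain ⟨c, rfl⟩ := hg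
      refine IsLocallyConstant.continuous ((IsLocallyConstant.iff_exists_open _).2 fun x =>
        ⟨{y | y • c = x • c}, hX _ _, rfl, fun y hy => ?_⟩)
      rw [LpCount.translateHom_apply, LpCount.translateHom_apply, LpCount.translate_delta,
        LpCount.translate_delta, hy]
    | zero => simpa using continuous_const
    | add g h _ _ hg hh => simpa only [map_add] using Continuous.fun_add hg hh
    | smul a g _ hg => simpa only [map_smul] using Continuous.fun_const_smul hg a
  refine continuous_of_uniform_approx_of_continuous fun u hu => ?_
  obtain ⟨ε, hε, hεu⟩ := Metric.mem_uniformity_dist.1 hu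
  obtain ⟨g, hg, hfg⟩ := (LpCount.dense_span_delta p hp_top).exists_dist_lt f hε
  exact ⟨_, hspan g hg, fun x => hεu (by rwa [LinearIsometryEquiv.dist_map])⟩

/-- The permutation representation on `ℓ_p(X)` of a group acting on `X` with open stabilizers. -/
noncomputable def permutationRep (p : ℝ≥0∞) [Fact (1 ≤ p)] (hp_top : p ≠ ⊤)
    (hX : ∀ a b : X, IsOpen {x : G | x • a = b}) : IsometricRep G where
  space := LpCount p X
  toHom := LpCount.translateHom p G X
  strongly_continuous := LpCount.continuous_translateHom p hp_top hX

/-- Any point mass is cyclic. If `K c` has positive finite measure and carries `c₀` to `c`, the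
normalized indicator of `K c` integrates the orbit of the point mass at `c₀` to exactly the point
mass at `c`. Integrable functions thus reach the whole span of point masses. -/
theorem permutationRep_isCyclic [IsTopologicalGroup G] [LocallyCompactSpace G]
    [MeasurableSpace G] [BorelSpace G] [MulAction.IsPretransitive G X] [Nonempty X]
    (p : ℝ≥0∞) [Fact (1 ≤ p)] (hp_top : p ≠ ⊤)
    (hX : ∀ a b : X, IsOpen {x : G | x • a = b}) :
    (permutationRep p hp_top hX).IsCyclic := by
  obtain ⟨c₀⟩ := ‹Nonempty X›
  let μ : Measure G := Measure.haar
  have hK : ∀ c : X, ∃ K : Set G, (∀ x ∈ K, x • c₀ = c) ∧ MeasurableSet K ∧ μ K ≠ 0 ∧ μ K ≠ ⊤ := by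
    intro c
    obtain ⟨x, hx⟩ := MulAction.exists_smul_eq G c₀ c
    obtain ⟨s, hxs, hs, hμs⟩ := μ.exists_isOpen_measure_lt_top x
    have ho : IsOpen (s ∩ {x : G | x • c₀ = c}) := hs.inter (hX _ _)
    exact ⟨_, fun y hy => hy.2, ho.measurableSet, ho.measure_ne_zero μ ⟨x, hxs, hx⟩,
      (lt_of_le_of_lt (measure_mono Set.inter_subset_left) hμs).ne⟩
  choose K hKc hKm hK0 hKtop using hK
  refine ⟨LpCount.delta p c₀, (LpCount.dense_span_delta p hp_top).mono ?_⟩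
  intro v hv
  obtain ⟨a, rfl⟩ := (Finsupp.mem_span_range_iff_exists_finsupp).1 hv
  refine ⟨fun x => ∑ c ∈ a.support, (K c).indicator (fun _ => a c / (μ.real (K c) : ℂ)) x,
    integrable_finsetSum _ fun c _ =>
    (integrable_indicator_iff (hKm c)).2 (integrableOn_const (hKtop c)), ?_⟩
  have hf : ∀ x : G,
      (∑ c ∈ a.support, (K c).indicator (fun _ => a c / (μ.real (K c) : ℂ)) x) •
        LpCount.translateHom p G X x (LpCount.delta p c₀) =
      ∑ c ∈ a.support, (K c).indicator
        (fun _ => (a c / (μ.real (K c) : ℂ)) • LpCount.delta p c) x := by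
    intro x
    rw [Finset.sum_smul]
    refine Finset.sum_congr rfl fun c _ => ?_
    by_cases hx : x ∈ K c
    · rw [Set.indicator_of_mem hx, Set.indicator_of_mem hx, LpCount.translateHom_apply,
        LpCount.translate_delta, hKc c x hx]
    · rw [Set.indicator_of_notMem hx, Set.indicator_of_notMem hx, zero_smul]
  change _ = ∫ x, (∑ c ∈ a.support, (K c).indicator (fun _ => a c / (μ.real (K c) : ℂ)) x) •
        LpCount.translateHom p G X x (LpCount.delta p c₀) ∂μ
  rw [integral_congr_ae (Filter.Eventually.of_forall hf),
    integral_finsetSum _ fun c _ =>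
    (integrable_indicator_iff (hKm c)).2 (integrableOn_const (hKtop c)), Finsupp.sum]
  refine Finset.sum_congr rfl fun c _ => ?_
  rw [integral_indicator_const _ (hKm c)]
  have : (μ.real (K c) : ℂ) ≠ 0 := by
    simpa [Measure.real, ENNReal.toReal_eq_zero_iff] using ⟨hK0 c, hKtop c⟩
  rw [RCLike.real_smul_eq_coe_smul (K := ℂ), smul_smul]
  congr 1
  exact (mul_div_cancel₀ _ this).symm

end PermutationRepresentation

/-! ### Expansions and the norm of `B_p(G)` -/

section Expansions

variable {G : Type u} [Group G] [TopologicalSpace G] [IsTopologicalGroup G]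
  [LocallyCompactSpace G] [MeasurableSpace G] [BorelSpace G] {p : ℝ≥0∞} [Fact (1 ≤ p)]

theorem HasBpExpansion.nonneg {u : G → ℂ} {c : ℝ} (h : HasBpExpansion p u c) : 0 ≤ c := by
  obtain ⟨_, _, _, _, hc, _⟩ := h
  exact hc.nonneg fun _ => by positivity

theorem HasBpExpansion.norm_apply_le {u : G → ℂ} {c : ℝ} (h : HasBpExpansion p u c) (x : G) :
    ‖u x‖ ≤ c := by
  obtain ⟨π, ξ, η, _, hc, hu⟩ := h
  refine (hu x).norm_le_of_bounded hc fun n => ?_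
  calc ‖η n ((π n).toHom x (ξ n))‖ ≤ ‖η n‖ * ‖(π n).toHom x (ξ n)‖ := (η n).le_opNorm _
    _ = ‖ξ n‖ * ‖η n‖ := by rw [LinearIsometryEquiv.norm_map, mul_comm]

theorem HasBpExpansion.of_single (π : IsometricRep G) (hπ : IsQSLp p π.space) (hc : π.IsCyclic)
    (ξ : π.space) (η : StrongDual ℂ π.space) :
    HasBpExpansion p (fun x => η (π.toHom x ξ)) (‖ξ‖ * ‖η‖) := by
  -- Every term must carry a cyclic representation, so the surplus terms repeat `π` and are killed
  -- by a zero functional.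
  refine ⟨fun _ => π, fun _ => ξ, fun n => if n = 0 then η else 0, fun _ => ⟨hπ, hc⟩, ?_,
    fun x => ?_⟩
  · convert hasSum_ite_eq 0 (‖ξ‖ * ‖η‖) using 2 with n
    rcases eq_or_ne n 0 with rfl | hn <;> simp [*]
  · convert hasSum_ite_eq 0 (η (π.toHom x ξ)) using 2 with n
    rcases eq_or_ne n 0 with rfl | hn <;> simp [*]

theorem HasBpExpansion.add {u v : G → ℂ} {c d : ℝ} (hu : HasBpExpansion p u c)
    (hv : HasBpExpansion p v d) : HasBpExpansion p (u + v) (c + d) := by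
  obtain ⟨π, ξ, η, h, hc, hs⟩ := hu
  obtain ⟨π', ξ', η', h', hc', hs'⟩ := hv
  -- The two sequences are interleaved, so no direct sum of representations is needed.
  let e := Equiv.natSumNatEquivNat.symm
  let ρ : ℕ ⊕ ℕ → IsometricRep G := Sum.elim π π'
  let α : ∀ n, (ρ n).space := fun n => match n with
    | .inl n => ξ n
    | .inr n => ξ' n
  let β : ∀ n, StrongDual ℂ (ρ n).space := fun n => match n with
    | .inl n => η n
    | .inr n => η' n
  have hρ : ∀ n, IsQSLp p (ρ n).space ∧ (ρ n).IsCyclic := fun n => match n with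
    | .inl n => h n
    | .inr n => h' n
  refine ⟨fun n => ρ (e n), fun n => α (e n), fun n => β (e n), fun n => hρ (e n), ?_, fun x => ?_⟩
  · exact e.hasSum_iff (f := fun n => ‖α n‖ * ‖β n‖) |>.2 (HasSum.sum hc hc')
  · exact e.hasSum_iff (f := fun n => β n ((ρ n).toHom x (α n))) |>.2
      (HasSum.sum (hs x) (hs' x))

theorem HasBpExpansion.const_smul {u : G → ℂ} {c : ℝ} (hu : HasBpExpansion p u c) (a : ℂ) :
    HasBpExpansion p (a • u) (‖a‖ * c) := by
  obtain ⟨π, ξ, η, h, hc, hs⟩ := hu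
  refine ⟨π, ξ, fun n => a • η n, h, ?_, fun x => ?_⟩
  · simpa only [norm_smul, mul_left_comm] using hc.mul_left ‖a‖
  · exact (hs x).const_smul a

theorem HasBpExpansion.sub {u v : G → ℂ} {c d : ℝ} (hu : HasBpExpansion p u c)
    (hv : HasBpExpansion p v d) : HasBpExpansion p (u - v) (c + d) := by
  simpa [sub_eq_add_neg] using hu.add (hv.const_smul (-1))

theorem normBp_le {u : G → ℂ} {c : ℝ} (h : HasBpExpansion p u c) : normBp p u ≤ c :=
  csInf_le ⟨0, fun _ hd => HasBpExpansion.nonneg hd⟩ h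

theorem one_le_normBp_indicator {Y : Set G} (hY : Y.Nonempty)
    (h : Y.indicator (1 : G → ℂ) ∈ FourierStieltjesBp G p) :
    1 ≤ normBp p (Y.indicator (1 : G → ℂ)) := by
  obtain ⟨y, hy⟩ := hY
  refine le_csInf h fun c hc => ?_
  simpa [hy] using HasBpExpansion.norm_apply_le hc y

end Expansions

/-! ### Open cosets and the ring they generate -/

section Cosets

variable {G : Type u} [Group G] [TopologicalSpace G]

theorem IsOpenCoset.inter {C D : Set G} (hC : IsOpenCoset C) (hD : IsOpenCoset D) :
    C ∩ D = ∅ ∨ IsOpenCoset (C ∩ D) := by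
  obtain ⟨H, a, rfl⟩ := hC
  obtain ⟨K, b, rfl⟩ := hD
  refine (Set.eq_empty_or_nonempty _).imp_right ?_
  rintro ⟨c, hca, hcb⟩
  -- Through a common point `c` the two cosets are `cH` and `cK`.
  refine ⟨H ⊓ K, c, ?_⟩
  have h1 : a • (H : Set G) = c • (H : Set G) :=
    (leftCoset_eq_iff (H : Subgroup G)).2 ((mem_leftCoset_iff a).1 hca)
  have h2 : b • (K : Set G) = c • (K : Set G) :=
    (leftCoset_eq_iff (K : Subgroup G)).2 ((mem_leftCoset_iff b).1 hcb)
  rw [h1, h2, OpenSubgroup.coe_inf, Set.smul_set_inter]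

theorem IsOpenSubcosetOfInfiniteIndex.isOpenCoset {C D : Set G}
    (h : IsOpenSubcosetOfInfiniteIndex C D) : IsOpenCoset C := by
  obtain ⟨_, H, _, a, _, rfl, _⟩ := h
  exact ⟨H, a, rfl⟩

theorem isSetRing_openCosetRing : IsSetRing (openCosetRing G) where
  empty_mem := fun _ hR => hR.1.empty_mem
  union_mem _ _ hs ht := fun R hR => hR.1.union_mem (hs R hR) (ht R hR)
  sdiff_mem _ _ hs ht := fun R hR => hR.1.sdiff_mem (hs R hR) (ht R hR)

theorem IsOpenCoset.mem_openCosetRing {C : Set G} (hC : IsOpenCoset C) : C ∈ openCosetRing G :=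
  fun _ hR => hR.2 C hC

theorem IsCosetDifference.mem_openCosetRing {Y : Set G} {m : ℕ} (h : IsCosetDifference Y m) :
    Y ∈ openCosetRing G := by
  obtain ⟨Y₀, Z, h₀, hZ, rfl⟩ := h
  refine isSetRing_openCosetRing.sdiff_mem h₀.mem_openCosetRing ?_
  simpa using isSetRing_openCosetRing.biUnion_mem Finset.univ
    fun i _ => (hZ i).isOpenCoset.mem_openCosetRing

/-- A coset is not a finite union of subcosets of infinite index. -/
theorem IsCosetDifference.nonempty {Y : Set G} {m : ℕ} (h : IsCosetDifference Y m) :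
    Y.Nonempty := by
  obtain ⟨_, Z, ⟨K, b, rfl⟩, hZ, rfl⟩ := h
  rw [Set.sdiff_nonempty]
  intro hcov
  -- Containment in `bK` forces the `i`-th coset to be `b k H` with `k ∈ K` and `H ≤ K`.
  have hZ' : ∀ i, ∃ (H : Subgroup G) (k : K), Z i = (b * k) • (H : Set G) ∧ H ≤ K ∧
      ¬ H.IsFiniteRelIndex K := by
    intro i
    obtain ⟨hsub, H, L, a, b', h1, h2, hind⟩ := hZ i
    rw [h1] at hsub
    obtain ⟨k, hk, hak⟩ := Set.mem_smul_set.1 (hsub (Set.mem_smul_set.2 ⟨1, H.one_mem, mul_one a⟩))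
    have hak' : b * k = a := by simpa using hak
    subst hak'
    have hHK : (H : Subgroup G) ≤ K := by
      intro x hx
      obtain ⟨l, hl, hxl⟩ := Set.mem_smul_set.1 (hsub (Set.mem_smul_set.2 ⟨x, hx, rfl⟩))
      have : l = k * x := by simpa [mul_assoc] using hxl
      exact (K.mul_mem_cancel_left hk).1 (this ▸ hl)
    -- The infinite-index condition comes with its own subgroup `L` for the ambient coset; a left
    -- coset determines its subgroup, so `L` is `K`.
    have hLK : (L : Subgroup G) = K := by
      have hmem : b ∈ b' • (L : Set G) := h2 ▸ Set.mem_smul_set.2 ⟨1, K.one_mem, mul_one b⟩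
      have h3 : b' • (L : Set G) = b • (L : Set G) :=
        (leftCoset_eq_iff (L : Subgroup G)).2 ((mem_leftCoset_iff b').1 hmem)
      rw [h3] at h2
      exact congrArg _ (SetLike.coe_injective (smul_left_cancel _ h2)).symm
    exact ⟨H, ⟨k, hk⟩, h1, hHK, hLK ▸ hind⟩
  choose H k hZk hHK hind using hZ'
  -- Cancelling `b` turns the covering of `bK` into a finite covering of the group `K` by cosets of
  -- its subgroups. Neumann's lemma then makes one of them of finite index.
  have hcover : ⋃ i ∈ (Finset.univ : Finset (Fin m)),
      k i • ((H i).subgroupOf K : Set K) = Set.univ := by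
    refine Set.eq_univ_of_forall fun x => ?_
    obtain ⟨i, hi⟩ := Set.mem_iUnion.1 (hcov (Set.mem_smul_set.2 ⟨x, x.2, rfl⟩))
    rw [hZk, Set.mem_smul_set] at hi
    obtain ⟨y, hy, hxy⟩ := hi
    have hxy' : (k i : G) * y = x := by simpa [mul_assoc] using hxy
    refine Set.mem_iUnion₂.2 ⟨i, Finset.mem_univ i, Set.mem_smul_set.2 ⟨⟨y, hHK i hy⟩, hy, ?_⟩⟩
    exact Subtype.ext hxy'
  obtain ⟨i, _, hi⟩ := Subgroup.exists_finiteIndex_of_leftCoset_cover hcover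
  exact hind i (Subgroup.isFiniteRelIndex_iff_finiteIndex.2 hi)

end Cosets

/-! ### The algebra spanned by coset indicators -/

section CosetSpan

variable {G : Type u} [Group G] [TopologicalSpace G]

theorem isOpenCoset_univ :
    IsOpenCoset (Set.univ : Set G) :=
  ⟨⊤, 1, by simp⟩

theorem indicator_diff_eq_sub {α : Type*} (A B : Set α) :
    (A \ B).indicator (1 : α → ℂ) = A.indicator 1 - A.indicator 1 * B.indicator 1 := by
  classical
  ext x
  by_cases hA : x ∈ A <;> by_cases hB : x ∈ B <;> simp [hA, hB]

theorem indicator_union_eq {α : Type*} (A B : Set α) :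
    (A ∪ B).indicator (1 : α → ℂ) =
      A.indicator 1 + B.indicator 1 - A.indicator 1 * B.indicator 1 := by
  classical
  ext x
  by_cases hA : x ∈ A <;> by_cases hB : x ∈ B <;> simp [hA, hB]

variable (G) in
/-- The linear span of the indicator functions of the open cosets. -/
noncomputable def openCosetSpan : Submodule ℂ (G → ℂ) :=
  Submodule.span ℂ {f | ∃ C : Set G, IsOpenCoset C ∧ f = C.indicator 1}

theorem mul_mem_openCosetSpan {f g : G → ℂ} (hf : f ∈ openCosetSpan G)
    (hg : g ∈ openCosetSpan G) : f * g ∈ openCosetSpan G := by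
  have h := Submodule.mul_mem_mul hf hg
  rw [openCosetSpan, Submodule.span_mul_span] at h
  refine Submodule.span_le.2 ?_ h
  rintro _ ⟨_, ⟨C, hC, rfl⟩, _, ⟨D, hD, rfl⟩, rfl⟩
  change C.indicator 1 * D.indicator 1 ∈ openCosetSpan G
  rw [← Set.inter_indicator_one]
  rcases hC.inter hD with h | h
  · rw [h, Set.indicator_empty']
    exact zero_mem _
  · exact Submodule.subset_span ⟨_, h, rfl⟩

theorem indicator_mem_openCosetSpan {Y : Set G} (hY : Y ∈ openCosetRing G) :
    Y.indicator (1 : G → ℂ) ∈ openCosetSpan G := by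
  -- The sets with indicator in the span form a ring containing the open cosets, hence contain the
  -- generated ring.
  refine hY {Y | Y.indicator (1 : G → ℂ) ∈ openCosetSpan G} ⟨⟨?_, ?_, ?_⟩, ?_⟩
  · rw [Set.mem_ofPred_eq, Set.indicator_empty']
    exact zero_mem _
  · intro A B hA hB
    rw [Set.mem_ofPred_eq, indicator_union_eq]
    exact sub_mem (add_mem hA hB) (mul_mem_openCosetSpan hA hB)
  · intro A B hA hB
    rw [Set.mem_ofPred_eq, indicator_diff_eq_sub]
    exact sub_mem hA (mul_mem_openCosetSpan hA hB)
  · exact fun C hC => Submodule.subset_span ⟨C, hC, rfl⟩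

end CosetSpan

/-! ### Expansions of coset indicators and the bound `2 ^ m` -/

section CosetExpansions

variable {G : Type u} [Group G] [TopologicalSpace G] [IsTopologicalGroup G]
  [LocallyCompactSpace G] [MeasurableSpace G] [BorelSpace G]

theorem IsOpenCoset.exists_expansion (p : ℝ≥0∞) [Fact (1 ≤ p)] (hp_top : p ≠ ⊤) {C : Set G}
    (hC : IsOpenCoset C) : ∃ c ≤ 1, HasBpExpansion p (C.indicator (1 : G → ℂ)) c := by
  classical
  obtain ⟨H, a, rfl⟩ := hC
  let X := G ⧸ (H : Subgroup G)
  let _ : MeasurableSpace X := ⊤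
  have : DiscreteMeasurableSpace X := inferInstanceAs (@DiscreteMeasurableSpace X ⊤)
  have : DiscreteTopology X := QuotientGroup.discreteTopology H.isOpen
  have hX : ∀ b d : X, IsOpen {x : G | x • b = d} := fun b d =>
    (isOpen_discrete {d}).preimage (continuous_id.smul continuous_const)
  let e : G → X := fun x => QuotientGroup.mk x
  have h := HasBpExpansion.of_single (permutationRep p hp_top hX) (isQSLp_lp p _)
    (permutationRep_isCyclic p hp_top hX) (LpCount.delta p (e 1)) (LpCount.eval hp_top (e a))
  have hu : (a • (H : Set G)).indicator (1 : G → ℂ) = fun x =>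
      LpCount.eval hp_top (e a) (LpCount.translate p x (LpCount.delta p (e 1))) := by
    ext x
    rw [LpCount.eval_apply, LpCount.translate_delta, LpCount.delta_apply, Set.indicator_apply]
    -- The translated point mass sits at `xH`, and `x ∈ aH` means `xH = aH`.
    have : x ∈ a • (H : Set G) ↔ e a = x • e 1 := by
      change _ ↔ (QuotientGroup.mk a : X) = QuotientGroup.mk (x * 1)
      rw [mul_one, QuotientGroup.eq, Set.mem_smul_set_iff_inv_smul_mem]
      rfl
    simp only [this]
    congr
  refine ⟨‖LpCount.delta p (e 1)‖ *
    ‖(LpCount.eval hp_top (e a) : StrongDual ℂ (LpCount p X))‖, ?_, ?_⟩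
  · exact (mul_le_mul (LpCount.norm_delta p hp_top _).le (LpCount.norm_eval_le hp_top _)
      (norm_nonneg _) zero_le_one).trans_eq (one_mul 1)
  · rw [hu]
    exact h

variable (G) in
theorem HasBpExpansion.zero (p : ℝ≥0∞) [Fact (1 ≤ p)] (hp_top : p ≠ ⊤) :
    HasBpExpansion p (0 : G → ℂ) 0 := by
  obtain ⟨c, -, hc⟩ := IsOpenCoset.exists_expansion p hp_top (isOpenCoset_univ (G := G))
  simpa using hc.const_smul 0

theorem openCosetSpan_subset (p : ℝ≥0∞) [Fact (1 ≤ p)] (hp_top : p ≠ ⊤) {f : G → ℂ}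
    (hf : f ∈ openCosetSpan G) : f ∈ FourierStieltjesBp G p := by
  induction hf using Submodule.span_induction with
  | mem f hf =>
    obtain ⟨C, hC, rfl⟩ := hf
    obtain ⟨c, -, hc⟩ := hC.exists_expansion p hp_top
    exact ⟨c, hc⟩
  | zero => exact ⟨0, HasBpExpansion.zero G p hp_top⟩
  | add f g _ _ hf hg =>
    obtain ⟨c, hc⟩ := hf
    obtain ⟨d, hd⟩ := hg
    exact ⟨_, hc.add hd⟩
  | smul a f _ hf =>
    obtain ⟨c, hc⟩ := hf
    exact ⟨_, hc.const_smul a⟩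

/-- With `U` the union over `s`, the indicator of `C \ (Z a ∪ U)` is that of `C \ U` minus that of
`(C ∩ Z a) \ U`. Both have cost at most `2 ^ s.card`. The induction runs over all cosets `C` at once
because the second term replaces `C` by `C ∩ Z a`, which is empty or again an open coset. -/
theorem exists_expansion_diff_biUnion (p : ℝ≥0∞) [Fact (1 ≤ p)] (hp_top : p ≠ ⊤) {ι : Type*}
    (s : Finset ι) {Z : ι → Set G} (hZ : ∀ i ∈ s, IsOpenCoset (Z i)) {C : Set G}
    (hC : IsOpenCoset C) :
    ∃ c ≤ 2 ^ s.card, HasBpExpansion p ((C \ ⋃ i ∈ s, Z i).indicator (1 : G → ℂ)) c := by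
  classical
  induction s using Finset.induction_on generalizing C with
  | empty => simpa using hC.exists_expansion p hp_top
  | insert a s ha ih =>
    have hZs : ∀ i ∈ s, IsOpenCoset (Z i) := fun i hi => hZ i (Finset.mem_insert_of_mem hi)
    obtain ⟨c, hc, hce⟩ := ih hZs hC
    obtain ⟨d, hd, hde⟩ : ∃ d ≤ (2 : ℝ) ^ s.card,
        HasBpExpansion p (((C ∩ Z a) \ ⋃ i ∈ s, Z i).indicator (1 : G → ℂ)) d := by
      rcases hC.inter (hZ a (Finset.mem_insert_self a s)) with h | h
      · refine ⟨0, by positivity, ?_⟩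
        rw [h, Set.empty_sdiff, Set.indicator_empty']
        exact HasBpExpansion.zero G p hp_top
      · exact ih hZs h
    refine ⟨c + d, ?_, ?_⟩
    · rw [Finset.card_insert_of_notMem ha, pow_succ]
      linarith
    · convert hce.sub hde using 1
      ext x
      rw [Finset.set_biUnion_insert]
      by_cases h1 : x ∈ C <;> by_cases h2 : x ∈ Z a <;> by_cases h3 : x ∈ ⋃ i ∈ s, Z i <;>
        simp only [Set.indicator_apply, Pi.sub_apply, Set.mem_sdiff, Set.mem_union,
          Set.mem_inter_iff, h1, h2, h3] <;> simp

theorem IsCosetDifference.normBp_le (p : ℝ≥0∞) [Fact (1 ≤ p)] (hp_top : p ≠ ⊤) {Y : Set G}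
    {m : ℕ} (h : IsCosetDifference Y m) : normBp p (Y.indicator (1 : G → ℂ)) ≤ 2 ^ m := by
  obtain ⟨Y₀, Z, h₀, hZ, rfl⟩ := h
  obtain ⟨c, hc, hce⟩ := exists_expansion_diff_biUnion p hp_top Finset.univ
    (fun i _ => (hZ i).isOpenCoset) h₀
  simp only [Finset.mem_univ, Set.iUnion_true, Finset.card_univ, Fintype.card_fin] at hc hce
  exact (_root_.normBp_le hce).trans hc

end CosetExpansions

theorem mainTheorem6 {G : Type u} [Group G] [TopologicalSpace G] [IsTopologicalGroup G]
    [LocallyCompactSpace G] [MeasurableSpace G] [BorelSpace G]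
    (p : ℝ≥0∞) [Fact (1 ≤ p)] (hp_gt : 1 < p) (hp_top : p ≠ ⊤) :
    (∀ Y ∈ openCosetRing G,
      Y.indicator (1 : G → ℂ) ∈ FourierStieltjesBp G p ∧
      (Y.Nonempty → 1 ≤ normBp p (Y.indicator (1 : G → ℂ)))) ∧
    (∀ Y : Set G, (∃ m : ℕ, IsCosetDifference Y m) →
      Y ∈ openCosetRing G ∧
      Y.indicator (1 : G → ℂ) ∈ FourierStieltjesBp G p ∧
      1 ≤ normBp p (Y.indicator (1 : G → ℂ)) ∧
      normBp p (Y.indicator (1 : G → ℂ)) ≤ 2 ^ cosetNumber Y) := by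
  have hmem : ∀ Y ∈ openCosetRing G, Y.indicator (1 : G → ℂ) ∈ FourierStieltjesBp G p :=
    fun Y hY => openCosetSpan_subset p hp_top (indicator_mem_openCosetSpan hY)
  refine ⟨fun Y hY => ⟨hmem Y hY, fun hne => one_le_normBp_indicator hne (hmem Y hY)⟩, ?_⟩
  rintro Y ⟨m, hm⟩
  have hY := hm.mem_openCosetRing
  exact ⟨hY, hmem Y hY, one_le_normBp_indicator hm.nonempty (hmem Y hY),
    -- The set of admissible `m` is nonempty, so its infimum in `ℕ` is attained by an actual
    -- decomposition.
    IsCosetDifference.normBp_le p hp_top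
      (Nat.sInf_mem (s := {m | IsCosetDifference Y m}) ⟨m, hm⟩)⟩
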